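/- Let $P'$ be a polygon* with vertices $v_1,\dots,v_n$ ($n\ge 3$), listed counterclockwise around its boundary: a weakly simple polygon (a limit, in the Fréchet distance, of simple closed curves) whose vertices are distinct and whose interior angles are strictly between $0$ and $2\pi$. Assume that no three consecutive vertices of $P'$ along its boundary are collinear. A diagonal of $P'$ is a segment that joins two non-adjacent vertices and is contained in $P'$ (it may contain boundary points of $P'$ in its interior). A triangulation of $P'$ is a decomposition of $P'$ into triangles by a maximal set of pairwise non-crossing, but possibly overlapping, diagonals. Here two diagonals cross if their endpoints alternate along the boundary, and decomposition means that the triangles cover $P'$, have pairwise disjoint interiors, and fill around each vertex exactly the interior angle of $P'$. A triangle of a triangulation is degenerate if its three vertices are collinear. The dual graph $G(\mathcal T)$ of a triangulation $\mathcal T$ has the triangles of $\mathcal T$ as nodes, two of them being adjacent if they share a diagonal of $\mathcal T$; a vertex is associated with a leaf of $G(\mathcal T)$ if it is an endpoint of the side of that triangle which is a diagonal. **Lemma.** Let $\mathcal T$ be a triangulation of $P'$, and let $v_1$ be a vertex of $P'$ with interior angle less than $\pi$ that is associated with two different leaves of $G(\mathcal T)$. Then there is a triangulation $\mathcal T'$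 of $P'$ in which none of the triangles incident to $v_1$ is degenerate. Moreover, $\mathcal T'$ can be obtained from $\mathcal T$ by a finite (possibly empty) sequence of steps of the following kind, all intermediate sets of diagonals being triangulations of $P'$: two triangles $v_1ab$ and $v_1bc$ of the current triangulation, at least one of which is degenerate, share the diagonal $\overline{v_1b}$, and this diagonal is replaced by $\overline{ac}$. (If both triangles are degenerate, the step merges two adjacent degenerate triangles at $v_1$ into the one triangle $v_1ac$; otherwise it is a flip at the border between a degenerate and a non-degenerate triangle.) -/

import Mathlib

noncomputable section

namespace PolygonStar

/-! A closed polygon with `n` vertices is a map `v : ZMod n → ℂ`; the plane is `ℂ` and the indices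
are cyclic, so that the edges are the segments from `v i` to `v (i + 1)`. -/

/-- The boundary curve of the polygon, parametrised with period `n`: for `k : ℤ` the interval
`[k, k + 1]` is mapped affinely onto the edge from `v k` to `v (k + 1)`. -/
def curve {n : ℕ} (v : ZMod n → ℂ) (t : ℝ) : ℂ :=
  AffineMap.lineMap (v (⌊t⌋ : ZMod n)) (v ((⌊t⌋ : ZMod n) + 1)) (Int.fract t)

/-- The boundary of the polygon: the union of its edges. -/
def boundary {n : ℕ} (v : ZMod n → ℂ) : Set ℂ :=
  ⋃ i : ZMod n, segment ℝ (v i) (v (i + 1))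

/-- A polygon is weakly simple if there are simple closed curves arbitrarily close to it in the
Fréchet distance. (A reparametrisation of a simple closed curve is again a simple closed curve, so
the Fréchet distance may be measured along the fixed parametrisation `curve v`.) -/
def IsWeaklySimple {n : ℕ} (v : ZMod n → ℂ) : Prop :=
  ∀ ε : ℝ, 0 < ε → ∃ γ : ℝ → ℂ, Continuous γ ∧ Function.Periodic γ (n : ℝ) ∧
    Set.InjOn γ (Set.Ico 0 (n : ℝ)) ∧ ∀ t, dist (γ t) (curve v t) < ε

/-- The (shoelace) signed area of the polygon; it is positive when the vertices of a weakly simple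
polygon are listed counterclockwise. -/
def signedArea {n : ℕ} [NeZero n] (v : ZMod n → ℂ) : ℝ :=
  (∑ i : ZMod n, (starRingEnd ℂ (v i) * v (i + 1)).im) / 2

/-- The interior angle at the vertex `i` of a polygon listed counterclockwise: the angle in
`[0, 2π)` through which the ray from `v i` to `v (i + 1)` turns counterclockwise until it reaches
the ray from `v i` to `v (i - 1)`. An angle `0` or `2π` (a spur) is returned as `0`. -/
def interiorAngle {n : ℕ} (v : ZMod n → ℂ) (i : ZMod n) : ℝ :=
  toIcoMod Real.two_pi_pos 0 (Complex.arg ((v (i - 1) - v i) / (v (i + 1) - v i)))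

/-- A polygon*: a weakly simple polygon, listed counterclockwise, with distinct vertices, all of
whose interior angles are strictly between `0` and `2π`. -/
structure IsPolygonStar {n : ℕ} [NeZero n] (v : ZMod n → ℂ) : Prop where
  three_le : 3 ≤ n
  weaklySimple : IsWeaklySimple v
  counterclockwise : 0 < signedArea v
  injective : Function.Injective v
  angle_pos : ∀ i, 0 < interiorAngle v i
  angle_lt : ∀ i, interiorAngle v i < 2 * Real.pi

/-- `2π` times the winding number of the polygon around a point `p` off its boundary. -/
def totalTurn {n : ℕ} [NeZero n] (v : ZMod n → ℂ) (p : ℂ) : ℝ :=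
  ∑ i : ZMod n, Complex.arg ((v (i + 1) - p) / (v i - p))

/-- The polygon as a closed region: its boundary together with the points off the boundary around
which it winds. -/
def region {n : ℕ} [NeZero n] (v : ZMod n → ℂ) : Set ℂ :=
  boundary v ∪ {p | p ∉ boundary v ∧ totalTurn v p ≠ 0}

/-- Two indices span an edge of the polygon. -/
def IsEdge {n : ℕ} (a b : ZMod n) : Prop := b = a + 1 ∨ a = b + 1

/-- A chord: an unordered pair of distinct non-adjacent indices. -/
def IsChord {n : ℕ} (d : Sym2 (ZMod n)) : Prop :=
  ∃ a b, d = s(a, b) ∧ a ≠ b ∧ ¬ IsEdge a b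

/-- A diagonal: a segment between non-adjacent vertices that is contained in the polygon. It may
contain boundary points, even vertices, in its interior. -/
def IsDiagonal {n : ℕ} [NeZero n] (v : ZMod n → ℂ) (d : Sym2 (ZMod n)) : Prop :=
  ∃ a b, d = s(a, b) ∧ a ≠ b ∧ ¬ IsEdge a b ∧ segment ℝ (v a) (v b) ⊆ region v

/-- Two chords cross if their endpoints alternate along the boundary. Overlapping diagonals, which
share boundary points or parts of positive length, need not cross. -/
def Crosses {n : ℕ} (d e : Sym2 (ZMod n)) : Prop :=
  ∃ a b x y, d = s(a, b) ∧ e = s(x, y) ∧ sbtw a x b ∧ sbtw b y a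

/-- `a b` is a side of a triangle of `T`: an edge of the polygon or a member of `T`. -/
def IsSide {n : ℕ} (T : Set (Sym2 (ZMod n))) (a b : ZMod n) : Prop :=
  IsEdge a b ∨ s(a, b) ∈ T

/-- `i, j, k`, in the cyclic order of the boundary, are the vertices of a triangle of `T`. -/
def IsTriangle {n : ℕ} (T : Set (Sym2 (ZMod n))) (i j k : ZMod n) : Prop :=
  sbtw i j k ∧ IsSide T i j ∧ IsSide T j k ∧ IsSide T k i

/-- The triangles of `T`, as sets of three indices. -/
def Triangle {n : ℕ} (T : Set (Sym2 (ZMod n))) : Type :=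
  {t : Finset (ZMod n) // ∃ i j k, t = {i, j, k} ∧ IsTriangle T i j k}

/-- The closed plane triangle (possibly a segment) spanned by a triangle of `T`. -/
def Triangle.hull {n : ℕ} {T : Set (Sym2 (ZMod n))} (v : ZMod n → ℂ) (t : Triangle T) : Set ℂ :=
  convexHull ℝ (v '' (t.1 : Set (ZMod n)))

open Classical in
/-- The sum of the angles at the vertex `i` of all triangles of `T` incident to it. -/
def angleSum {n : ℕ} [NeZero n] (v : ZMod n → ℂ) (T : Set (Sym2 (ZMod n))) (i : ZMod n) : ℝ :=
  ∑ p : ZMod n × ZMod n,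
    if IsTriangle T i p.1 p.2 then EuclideanGeometry.angle (v p.1) (v i) (v p.2) else 0

/-- A triangulation: a decomposition of the polygon into triangles by a maximal set of pairwise
non-crossing (but possibly overlapping) diagonals. The last three fields say that the triangles,
which may have collinear vertices, decompose the polygon: they cover it, they do not overlap, and
around every vertex they fill exactly the interior angle (this last condition is what ties the
triangles without area to the polygon). -/
structure IsTriangulation {n : ℕ} [NeZero n] (v : ZMod n → ℂ) (T : Set (Sym2 (ZMod n))) :
    Prop where
  diagonal : ∀ d ∈ T, IsDiagonal v d
  noncrossing : ∀ d ∈ T, ∀ e ∈ T, ¬ Crosses d e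
  maximal : ∀ d, IsChord d → (∀ e ∈ T, ¬ Crosses d e) → d ∈ T
  cover : ⋃ t : Triangle T, t.hull v = region v
  disjoint : ∀ s t : Triangle T, s ≠ t → Disjoint (interior (s.hull v)) (interior (t.hull v))
  angle_sum : ∀ i, angleSum v T i = interiorAngle v i

/-- The dual graph: the nodes are the triangles, two of them being adjacent if they share a
diagonal of `T`. -/
def dualGraph {n : ℕ} (T : Set (Sym2 (ZMod n))) : SimpleGraph (Triangle T) where
  Adj s t := s ≠ t ∧ ∃ a b, s(a, b) ∈ T ∧ a ∈ s.1 ∧ b ∈ s.1 ∧ a ∈ t.1 ∧ b ∈ t.1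
  symm := ⟨fun _ _ ⟨h, a, b, hT, h1, h2, h3, h4⟩ => ⟨h.symm, a, b, hT, h3, h4, h1, h2⟩⟩
  loopless := ⟨fun _ h => h.1 rfl⟩

/-- A leaf of the dual graph: a node of degree one. -/
def IsLeaf {n : ℕ} (T : Set (Sym2 (ZMod n))) (t : Triangle T) : Prop :=
  ((dualGraph T).neighborSet t).ncard = 1

/-- The vertex `i` is associated with the leaf `t`: it is an endpoint of the side of `t` that is a
diagonal. -/
def IsAssociated {n : ℕ} (T : Set (Sym2 (ZMod n))) (i : ZMod n) (t : Triangle T) : Prop :=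
  i ∈ t.1 ∧ ∃ a ∈ t.1, s(i, a) ∈ T

/-- The triangle with vertices `v i`, `v j`, `v k` is degenerate. -/
def IsDegenerate {n : ℕ} (v : ZMod n → ℂ) (i j k : ZMod n) : Prop :=
  Collinear ℝ {v i, v j, v k}

/-- One retriangulation step at the vertex `i`: the diagonal between `i` and `b`, common side of
the triangles `i a b` and `i b c` at least one of which is degenerate, is flipped into the diagonal
between `a` and `c`; the result has to be a triangulation again. If both triangles are degenerate,
the step merges them into the single triangle `i a c` at `i`. -/
def FlipAt {n : ℕ} [NeZero n] (v : ZMod n → ℂ) (i : ZMod n) (T T' : Set (Sym2 (ZMod n))) : Prop :=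
  IsTriangulation v T ∧ IsTriangulation v T' ∧
    ∃ a b c, IsTriangle T i a b ∧ IsTriangle T i b c ∧
      (IsDegenerate v i a b ∨ IsDegenerate v i b c) ∧
      s(i, b) ∈ T ∧ T' = insert s(a, c) (T \ {s(i, b)})

end PolygonStar

end

/-! Induct on the number of diagonals at `i`, removing one degenerate triangle at a time. The angles
at `i` add up to the interior angle, which is below `π`, so in a degenerate triangle `i j k` the
vertex `i` cannot lie between the other two. Say `v j` lies strictly between `v i` and `v k`. If `i
k` is a diagonal, let `i k c` be the triangle across it. Since `v j` is on the segment from `v i` to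
`v k`, the triangle `i k c` is cut into `i j c` and `j k c`. Flipping `i k` to `j c` therefore keeps
cover, disjointness and angle sums (`isFlippable_of_sbtw`, `IsTriangulation.flip`), even if `v c` is
on the same line, and `i` loses a diagonal.

The long side `i k` could fail to be a diagonal only in a triangle on one of the two edges at `i`,
so the induction carries the invariant that these end triangles are nondegenerate. It survives a
flip: a degenerate new triangle `i a c`, together with one degenerate old triangle, puts both old
triangles on one line, and one of them was an end triangle. It holds at the start because two
different leaves associated with `i` must be the ears `i, i+1, i+2` and `i-2, i-1, i`, and
consecutive vertices are not collinear. -/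

namespace PolygonStar

/-! ### Maximal noncrossing sets of chords of a cyclically ordered set. -/

section Combinatorics

variable {n : ℕ}

/-- Turns cyclic order into linear inequalities between representatives, so that `omega` can settle
questions about crossing. -/
lemma sbtw_iff_val [NeZero n] {a b c : ZMod n} : sbtw a b c ↔
    a.val < b.val ∧ b.val < c.val ∨ b.val < c.val ∧ c.val < a.val ∨
      c.val < a.val ∧ a.val < b.val := by
  cases n with
  | zero => exact absurd rfl (NeZero.ne 0)
  | succ n => exact Fin.sbtw_iff

lemma eq_iff_val [NeZero n] {a b : ZMod n} : a = b ↔ a.val = b.val :=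
  (ZMod.val_injective n).eq_iff.symm

lemma val_add_one_cases [NeZero n] (h : 2 ≤ n) (a : ZMod n) :
    (a + 1).val = a.val + 1 ∧ a.val + 1 < n ∨ (a + 1).val = 0 ∧ a.val + 1 = n := by
  have h1 : (1 : ZMod n).val = 1 := by
    have := ZMod.val_natCast n 1
    rw [Nat.mod_eq_of_lt (by omega)] at this
    simpa using this
  have ha := a.val_lt
  rw [ZMod.val_add, h1]
  rcases Nat.lt_or_ge (a.val + 1) n with h | h
  · left; exact ⟨Nat.mod_eq_of_lt h, h⟩
  · right
    have : a.val + 1 = n := by omega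
    exact ⟨by rw [this, Nat.mod_self], this⟩

lemma isEdge_iff_val [NeZero n] (h : 2 ≤ n) {a b : ZMod n} : IsEdge a b ↔
    b.val = a.val + 1 ∨ a.val = b.val + 1 ∨ (b.val = 0 ∧ a.val + 1 = n) ∨
      (a.val = 0 ∧ b.val + 1 = n) := by
  unfold IsEdge
  rw [eq_iff_val, eq_iff_val (a := a)]
  have := val_add_one_cases h a
  have := val_add_one_cases h b
  have := a.val_lt
  have := b.val_lt
  omega

lemma IsEdge.symm {a b : ZMod n} (h : IsEdge a b) : IsEdge b a := Or.symm h

lemma not_sbtw_of_isEdge [NeZero n] (h : 2 ≤ n) {a b x y : ZMod n} (he : IsEdge a b)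
    (h1 : sbtw a x b) (h2 : sbtw b y a) : False := by
  rw [isEdge_iff_val h] at he
  rw [sbtw_iff_val] at h1 h2
  have := x.val_lt
  have := y.val_lt
  omega

lemma sbtw_rotate {a b c : ZMod n} (h : sbtw a b c) : sbtw b c a := sbtw_cyclic_left h

lemma crosses_iff {a b x y : ZMod n} : Crosses s(a, b) s(x, y) ↔
    (sbtw a x b ∧ sbtw b y a) ∨ (sbtw a y b ∧ sbtw b x a) := by
  constructor
  · rintro ⟨a', b', x', y', h1, h2, h3, h4⟩
    rw [Sym2.eq_iff] at h1 h2
    rcases h1 with ⟨rfl, rfl⟩ | ⟨rfl, rfl⟩ <;> rcases h2 with ⟨rfl, rfl⟩ | ⟨rfl, rfl⟩ <;> tauto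
  · rintro (⟨h1, h2⟩ | ⟨h1, h2⟩)
    · exact ⟨a, b, x, y, rfl, rfl, h1, h2⟩
    · exact ⟨a, b, y, x, rfl, Sym2.eq_swap, h1, h2⟩

/-- A maximal set of pairwise noncrossing chords. -/
structure IsMaximalNoncrossing (T : Set (Sym2 (ZMod n))) : Prop where
  chord : ∀ d ∈ T, IsChord d
  noncrossing : ∀ d ∈ T, ∀ e ∈ T, ¬ Crosses d e
  maximal : ∀ d, IsChord d → (∀ e ∈ T, ¬ Crosses d e) → d ∈ T

lemma isChord_iff {a b : ZMod n} : IsChord s(a, b) ↔ a ≠ b ∧ ¬ IsEdge a b := by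
  constructor
  · rintro ⟨x, y, h, hne, he⟩
    rw [Sym2.eq_iff] at h
    rcases h with ⟨rfl, rfl⟩ | ⟨rfl, rfl⟩
    · exact ⟨hne, he⟩
    · exact ⟨hne.symm, fun h => he h.symm⟩
  · exact fun h => ⟨a, b, rfl, h.1, h.2⟩

variable {T : Set (Sym2 (ZMod n))}

lemma IsSide.symm {a b : ZMod n} (h : IsSide T a b) : IsSide T b a :=
  h.imp IsEdge.symm fun h => Sym2.eq_swap (a := a) (b := b) ▸ h

lemma IsTriangle.rotate {i j k : ZMod n} (h : IsTriangle T i j k) : IsTriangle T j k i :=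
  ⟨sbtw_rotate h.1, h.2.2.1, h.2.2.2, h.2.1⟩

lemma ne_of_sbtw [NeZero n] {a b c : ZMod n} (h : sbtw a b c) : a ≠ b ∧ b ≠ c ∧ c ≠ a := by
  rw [sbtw_iff_val] at h
  simp only [ne_eq, eq_iff_val]
  omega

namespace IsMaximalNoncrossing

variable [NeZero n] (h2 : 2 ≤ n) (hT : IsMaximalNoncrossing T)
include h2 hT

/-- An edge has no vertex on one of its sides, so nothing crosses it. Edges and diagonals can thus
be treated alike as sides of triangles. -/
lemma not_sides_cross {a b x y : ZMod n} (hab : IsSide T a b) (hxy : IsSide T x y) :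
    ¬ (sbtw a x b ∧ sbtw b y a) := by
  rintro ⟨h1, h3⟩
  rcases hab with hab | hab
  · exact not_sbtw_of_isEdge h2 hab h1 h3
  rcases hxy with hxy | hxy
  · refine not_sbtw_of_isEdge h2 hxy (x := b) (y := a) ?_ ?_ <;>
    · rw [sbtw_iff_val] at *
      omega
  · exact hT.noncrossing _ hab _ hxy (crosses_iff.2 (.inl ⟨h1, h3⟩))

/-- With two different apexes on the same side of `a b`, the side from `a` to the one nearer to `b`
would cross the side from `b` to the other. -/
lemma triangle_unique {a b c d : ZMod n} (h : IsTriangle T a b c) (h' : IsTriangle T a b d) :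
    c = d := by
  by_contra hne
  obtain ⟨hs, -, hbc, hca⟩ := h
  obtain ⟨hs', -, hbd, hda⟩ := h'
  have h3 := hT.not_sides_cross h2 hca hbd.symm
  have h4 := hT.not_sides_cross h2 hda hbc.symm
  simp only [sbtw_iff_val, eq_iff_val] at *
  omega

/-- Every diagonal has a triangle on each side. -/
lemma exists_triangle {a b : ZMod n} (hab : s(a, b) ∈ T) : ∃ c, IsTriangle T a b c := by
  obtain ⟨hne, hedge⟩ := isChord_iff.1 (hT.chord _ hab)
  rw [isEdge_iff_val h2] at hedge
  rw [Ne, eq_iff_val] at hne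
  have ha := a.val_lt
  have hb := b.val_lt
  have hb1 := val_add_one_cases h2 b
  -- the farthest neighbour of `b` on the side of the chord running from `b` to `a`
  obtain ⟨c, ⟨hc, hbc⟩, hmax⟩ := Set.exists_max_image {c | sbtw a b c ∧ IsSide T b c}
    (fun c => if c.val < b.val then c.val + n else c.val) (Set.toFinite _)
    ⟨b + 1, by rw [sbtw_iff_val]; omega, Or.inl (Or.inl rfl)⟩
  refine ⟨c, hc, Or.inr hab, hbc, ?_⟩
  by_cases he : IsEdge c a
  · exact Or.inl he
  refine Or.inr (hT.maximal _ (isChord_iff.2 ⟨(ne_of_sbtw hc).2.2, he⟩) ?_)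
  intro e heT hcross
  induction e using Sym2.ind with
  | _ x y =>
  -- A diagonal crossing `c a` can cross neither `a b` nor `b c`, so it ends at `b`. Its other end
  -- is then a neighbour of `b` beyond `c`, against the choice of `c`; the shift by `n` measures
  -- position going round from `b`.
  have key : ∀ x y, s(x, y) ∈ T → sbtw c x a → sbtw a y c → False := by
    intro x y hxy h3 h4
    have h5 := hT.not_sides_cross h2 (Or.inr hab) (IsSide.symm (Or.inr hxy))
    have h6 := hT.not_sides_cross h2 hbc (IsSide.symm (Or.inr hxy))
    have hx := x.val_lt
    have hy := y.val_lt
    have hcv := c.val_lt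
    simp only [sbtw_iff_val] at hc h3 h4 h5 h6
    have hyb : y = b := by
      rw [eq_iff_val]
      omega
    subst hyb
    have h7 : sbtw a y x := by
      clear h5 h6 hb1 hedge hne hmax h4
      rw [sbtw_iff_val]
      omega
    have h8 := hmax x ⟨h7, IsSide.symm (Or.inr hxy)⟩
    clear h4 h5 h6 h7 hb1 hedge hne hmax
    split_ifs at h8 <;> omega
  rcases crosses_iff.1 hcross with ⟨h3, h4⟩ | ⟨h3, h4⟩
  · exact key x y heT h3 h4
  · exact key y x (Sym2.eq_swap (a := x) (b := y) ▸ heT) h3 h4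

end IsMaximalNoncrossing

end Combinatorics

/-! ### Plane geometry of a flip. -/

section Geometry

open EuclideanGeometry

/-- The two ways of cutting the quadrilateral `p q r s` along a diagonal give the same region and
the same angles at the vertices. -/
structure IsFlippable (p q r s : ℂ) : Prop where
  hull_union : convexHull ℝ {p, q, r} ∪ convexHull ℝ {p, r, s} =
    convexHull ℝ {p, q, s} ∪ convexHull ℝ {q, r, s}
  hull_subset : convexHull ℝ {p, q, s} ∪ convexHull ℝ {q, r, s} ⊆ convexHull ℝ {p, q, r} ∨
    convexHull ℝ {p, q, s} ∪ convexHull ℝ {q, r, s} ⊆ convexHull ℝ {p, r, s}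
  disjoint : Disjoint (interior (convexHull ℝ {p, q, s})) (interior (convexHull ℝ {q, r, s}))
  angle₁ : ∠ q p r + ∠ r p s = ∠ q p s
  angle₂ : ∠ p q r = ∠ p q s + ∠ s q r
  angle₃ : ∠ p r q + ∠ p r s = ∠ q r s
  angle₄ : ∠ p s r = ∠ p s q + ∠ q s r

lemma IsFlippable.symm {p q r s : ℂ} (h : IsFlippable p q r s) : IsFlippable p s r q where
  hull_union := by
    have e1 : ({p, s, r} : Set ℂ) = {p, r, s} := by rw [Set.pair_comm]
    have e2 : ({p, r, q} : Set ℂ) = {p, q, r} := by rw [Set.pair_comm]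
    have e3 : ({p, s, q} : Set ℂ) = {p, q, s} := by rw [Set.pair_comm]
    have e4 : ({s, r, q} : Set ℂ) = {q, r, s} := by
      rw [Set.insert_comm, Set.pair_comm, Set.insert_comm]
    rw [e1, e2, e3, e4, Set.union_comm, h.hull_union]
  hull_subset := by
    have e1 : ({p, s, r} : Set ℂ) = {p, r, s} := by rw [Set.pair_comm]
    have e2 : ({p, r, q} : Set ℂ) = {p, q, r} := by rw [Set.pair_comm]
    have e3 : ({p, s, q} : Set ℂ) = {p, q, s} := by rw [Set.pair_comm]
    have e4 : ({s, r, q} : Set ℂ) = {q, r, s} := by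
      rw [Set.insert_comm, Set.pair_comm, Set.insert_comm]
    rw [e1, e2, e3, e4]
    exact h.hull_subset.symm
  disjoint := by
    have e3 : ({p, s, q} : Set ℂ) = {p, q, s} := by rw [Set.pair_comm]
    have e4 : ({s, r, q} : Set ℂ) = {q, r, s} := by
      rw [Set.insert_comm, Set.pair_comm, Set.insert_comm]
    rw [e3, e4]
    exact h.disjoint
  angle₁ := by
    rw [angle_comm s p r, angle_comm r p q, angle_comm s p q, add_comm, h.angle₁]
  angle₂ := h.angle₄
  angle₃ := by rw [angle_comm s r q, add_comm, h.angle₃]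
  angle₄ := h.angle₂

/-- A triangle is cut into two by the segment from a vertex to a point of the opposite side. -/
lemma convexHull_union_convexHull_of_wbtw {p q r s : ℂ} (h : Wbtw ℝ p q r) :
    convexHull ℝ {p, q, s} ∪ convexHull ℝ {q, r, s} = convexHull ℝ {p, r, s} := by
  have hseg : segment ℝ p r = segment ℝ p q ∪ segment ℝ q r := by
    apply Set.Subset.antisymm
    · intro x hx
      rw [mem_segment_iff_wbtw] at hx
      obtain ⟨t, ht, rfl⟩ := h
      obtain ⟨u, hu, rfl⟩ := hx
      have hw : ∀ x y z : ℝ, x ≤ y → y ≤ z → Wbtw ℝ (AffineMap.lineMap p r x)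
          (AffineMap.lineMap p r y) (AffineMap.lineMap p r z : ℂ) := by
        intro x y z hxy hyz
        refine Wbtw.map ?_ _
        rw [← mem_segment_iff_wbtw, segment_eq_Icc (hxy.trans hyz)]
        exact ⟨hxy, hyz⟩
      rcases le_total u t with hut | hut
      · left
        simpa [mem_segment_iff_wbtw] using hw 0 u t hu.1 hut
      · right
        simpa [mem_segment_iff_wbtw] using hw t u 1 hut hu.2
    · rw [← mem_segment_iff_wbtw] at h
      exact Set.union_subset ((convex_segment p r).segment_subset (left_mem_segment ℝ p r) h)
        ((convex_segment p r).segment_subset h (right_mem_segment ℝ p r))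
  have hull : ∀ x y : ℂ, convexHull ℝ {x, y, s} = convexJoin ℝ {s} (segment ℝ x y) := by
    intro x y
    rw [show ({x, y, s} : Set ℂ) = insert s {x, y} by
      rw [Set.pair_comm, Set.insert_comm, Set.pair_comm], convexHull_insert (by simp),
      convexHull_pair]
  rw [hull, hull, hull, hseg, convexJoin_union_right]

/-- The line through `q` and `s` weakly separates `p` from `r`, so the two triangles meet only
within this line, which has empty interior. -/
lemma disjoint_interior_convexHull {p q r s : ℂ} (h : Wbtw ℝ p q r) (hqs : s ≠ q) :
    Disjoint (interior (convexHull ℝ {p, q, s})) (interior (convexHull ℝ {q, r, s})) := by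
  -- the linear form vanishing on the line through `q` and `s`
  let f : ℂ →ₗ[ℝ] ℝ := Complex.imLm ∘ₗ LinearMap.mulLeft ℝ (starRingEnd ℂ (s - q))
  have hf : ∀ z, f z = (starRingEnd ℂ (s - q) * z).im := fun z => rfl
  have hfs : f s = f q := by
    rw [← sub_eq_zero, ← map_sub, hf]
    simp only [Complex.mul_im, Complex.conj_re, Complex.conj_im]
    ring
  obtain ⟨t, ⟨ht0, ht1⟩, rfl⟩ := h
  set q := AffineMap.lineMap p r t with hq
  have hfq : f q = (1 - t) * f p + t * f r := by
    rw [hq, AffineMap.lineMap_apply_module, map_add, map_smul, map_smul, smul_eq_mul, smul_eq_mul]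
  have hle : ∀ c d e : ℂ, ∀ g : ℂ →ₗ[ℝ] ℝ, ∀ u, g c ≤ u → g d ≤ u → g e ≤ u →
      convexHull ℝ {c, d, e} ⊆ {z | g z ≤ u} := by
    intro c d e g u hc hd he
    refine convexHull_min ?_ (convex_halfSpace_le g.isLinear u)
    rintro z (rfl | rfl | rfl) <;> assumption
  have hge : ∀ c d e : ℂ, ∀ g : ℂ →ₗ[ℝ] ℝ, ∀ u, u ≤ g c → u ≤ g d → u ≤ g e →
      convexHull ℝ {c, d, e} ⊆ {z | u ≤ g z} := by
    intro c d e g u hc hd he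
    refine convexHull_min ?_ (convex_halfSpace_ge g.isLinear u)
    rintro z (rfl | rfl | rfl) <;> assumption
  have hsub : convexHull ℝ {p, q, s} ∩ convexHull ℝ {q, r, s} ⊆ {z | f z = f q} := by
    have hcases : f p ≤ f q ∧ f q ≤ f r ∨ f q ≤ f p ∧ f r ≤ f q := by
      by_contra! hcon
      rcases lt_trichotomy (f p) (f q) with hp | hp | hp
      · have h1 := hcon.1 hp.le
        rcases ht0.eq_or_lt with rfl | ht0
        · linarith
        · nlinarith [mul_pos ht0 (sub_pos.2 h1)]
      · exact (lt_asymm (hcon.1 hp.le) (hcon.2 hp.ge)).elim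
      · have h1 := hcon.2 hp.le
        rcases ht0.eq_or_lt with rfl | ht0
        · linarith
        · nlinarith [mul_pos ht0 (sub_pos.2 h1)]
    rintro z ⟨hz1, hz2⟩
    rcases hcases with ⟨hp, hr⟩ | ⟨hp, hr⟩
    · exact le_antisymm (hle _ _ _ f _ hp le_rfl hfs.le hz1) (hge _ _ _ f _ le_rfl hr hfs.ge hz2)
    · exact le_antisymm (hle _ _ _ f _ le_rfl hr hfs.le hz2) (hge _ _ _ f _ hp le_rfl hfs.ge hz1)
  rw [Set.disjoint_iff_inter_eq_empty, ← interior_inter, Set.eq_empty_iff_forall_notMem]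
  intro z hz
  have hz' := mem_interior_iff_mem_nhds.1 (interior_mono hsub hz)
  have hfz : f z = f q := hsub (interior_subset hz)
  -- Moving along the normal `I * (s - q)` changes `f` at the rate `|s - q|²`, which is nonzero, so
  -- no neighbourhood of `z` stays in the line.
  have hcont : Filter.Tendsto (fun ε : ℝ => z + ε • (Complex.I * (s - q))) (nhds 0) (nhds z) := by
    have : Continuous fun ε : ℝ => z + ε • (Complex.I * (s - q)) := by fun_prop
    simpa using this.tendsto 0
  obtain ⟨ε, hε, hmem⟩ := (((hcont.eventually hz').filter_mono nhdsWithin_le_nhds).and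
    (self_mem_nhdsWithin (s := Set.Ioi (0 : ℝ)))).exists
  have hmem : 0 < ε := hmem
  have hfε : f (z + ε • (Complex.I * (s - q))) = f q := hε
  rw [map_add, map_smul, hfz, add_eq_left, smul_eq_mul] at hfε
  rcases mul_eq_zero.1 hfε with h0 | h0
  · exact hmem.ne' h0
  · rw [hf, mul_left_comm, ← Complex.normSq_eq_conj_mul_self] at h0
    simp only [Complex.mul_im, Complex.I_re, Complex.I_im, Complex.ofReal_re, Complex.ofReal_im,
      zero_mul, one_mul, zero_add] at h0
    exact hqs (sub_eq_zero.1 (Complex.normSq_eq_zero.1 h0))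

/-- The triangle `p q r` is flat and the point `q` cuts `p r s` into the two new triangles. The flat
triangle has angle `π` at `q`, matching two supplementary angles, and `0` at `p` and `r`. The point
`s` may lie on the line as well. -/
lemma isFlippable_of_sbtw {p q r s : ℂ} (h : Sbtw ℝ p q r) (hp : s ≠ p) (hq : s ≠ q)
    (hr : s ≠ r) : IsFlippable p q r s where
  hull_union := by
    rw [convexHull_union_convexHull_of_wbtw h.wbtw, Set.union_eq_right]
    refine convexHull_min ?_ (convex_convexHull ℝ _)
    have hm : ∀ x ∈ ({p, r, s} : Set ℂ), x ∈ convexHull ℝ {p, r, s} :=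
      fun x hx => subset_convexHull ℝ _ hx
    rintro z (rfl | rfl | rfl)
    · exact hm _ (by simp)
    · exact (convex_convexHull ℝ {p, r, s}).segment_subset (hm p (by simp)) (hm r (by simp))
        (mem_segment_iff_wbtw.2 h.wbtw)
    · exact hm _ (by simp)
  hull_subset := Or.inr (convexHull_union_convexHull_of_wbtw h.wbtw).le
  disjoint := disjoint_interior_convexHull h.wbtw hq
  angle₁ := by
    rw [h.angle₂₁₃_eq_zero, zero_add, (h.angle_eq_left s)]
  angle₂ := by
    rw [angle_comm p q s, angle_add_angle_eq_pi_of_angle_eq_pi s h.angle₁₂₃_eq_pi, h.angle₁₂₃_eq_pi]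
  angle₃ := by
    rw [h.angle₁₃₂_eq_zero, zero_add, (h.symm.angle_eq_left s)]
  angle₄ := (angle_add_of_ne_of_ne hp hr h.wbtw).symm

end Geometry

/-! ### Combinatorics of a flip. -/

section Flip

variable {n : ℕ} {T : Set (Sym2 (ZMod n))} {i a b c : ZMod n}

lemma Crosses.symm [NeZero n] {d e : Sym2 (ZMod n)} (h : Crosses d e) : Crosses e d := by
  obtain ⟨a, b, x, y, rfl, rfl, h1, h2⟩ := h
  refine ⟨x, y, b, a, rfl, Sym2.eq_swap, ?_, ?_⟩ <;>
  · rw [sbtw_iff_val] at *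
    omega

/-- The triangles `i a b` and `i b c` of `T` share the diagonal between `i` and `b`. -/
structure IsQuad (T : Set (Sym2 (ZMod n))) (i a b c : ZMod n) : Prop where
  left : IsTriangle T i a b
  right : IsTriangle T i b c
  mem : s(i, b) ∈ T

/-- Replace the diagonal between `i` and `b` by the one between `a` and `c`. -/
def flip (T : Set (Sym2 (ZMod n))) (i a b c : ZMod n) : Set (Sym2 (ZMod n)) :=
  insert s(a, c) (T \ {s(i, b)})

/-- `(x, y, z)` is a cyclic rotation of `(i, j, k)`. -/
def IsRotation (x y z i j k : ZMod n) : Prop :=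
  x = i ∧ y = j ∧ z = k ∨ x = j ∧ y = k ∧ z = i ∨ x = k ∧ y = i ∧ z = j

lemma IsRotation.isTriangle {x y z : ZMod n} (h : IsRotation x y z i a b)
    (ht : IsTriangle T i a b) : IsTriangle T x y z := by
  rcases h with ⟨rfl, rfl, rfl⟩ | ⟨rfl, rfl, rfl⟩ | ⟨rfl, rfl, rfl⟩
  · exact ht
  · exact ht.rotate
  · exact ht.rotate.rotate

lemma IsEdge.ne_of_isChord {x y : ZMod n} {d : Sym2 (ZMod n)} (h : IsEdge x y) (hd : IsChord d) :
    s(x, y) ≠ d := by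
  rintro rfl
  exact (isChord_iff.1 hd).2 h

namespace IsQuad

variable [NeZero n] (h2 : 2 ≤ n) (hT : IsMaximalNoncrossing T) (h : IsQuad T i a b c)

include h in
lemma sbtw_rot : sbtw a c i ∧ sbtw a b c := by
  have h1 := h.left.1
  have h2 := h.right.1
  rw [sbtw_iff_val] at *
  rw [sbtw_iff_val]
  omega

include h in
lemma crosses : Crosses s(a, c) s(i, b) := by
  have h1 := h.left.1
  have h2 := h.right.1
  refine crosses_iff.2 (.inr ⟨?_, ?_⟩) <;>
  · rw [sbtw_iff_val] at *
    omega

include h in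
lemma ne : i ≠ a ∧ i ≠ b ∧ i ≠ c ∧ a ≠ b ∧ a ≠ c ∧ b ≠ c := by
  have h1 := ne_of_sbtw h.left.1
  have h2 := ne_of_sbtw h.right.1
  have h3 := ne_of_sbtw h.sbtw_rot.1
  exact ⟨h1.1, h2.1, h2.2.2.symm, h1.2.1, h3.1, h2.2.1⟩

include h h2 in
lemma isChord : IsChord s(a, c) := by
  refine isChord_iff.2 ⟨h.ne.2.2.2.2.1, fun he => not_sbtw_of_isEdge h2 he
    h.sbtw_rot.2 (sbtw_rotate h.sbtw_rot.1)⟩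

include hT h in
lemma notMem : s(a, c) ∉ T := fun hm => hT.noncrossing _ hm _ h.mem h.crosses

omit [NeZero n] in
lemma mem_flip {d : Sym2 (ZMod n)} : d ∈ flip T i a b c ↔ d = s(a, c) ∨ d ∈ T ∧ d ≠ s(i, b) := by
  simp [flip]

include h2 hT h

/-- A diagonal of `T` crossing the new diagonal is the old diagonal. -/
lemma eq_of_crosses {d : Sym2 (ZMod n)} (hd : d ∈ T) (hcr : Crosses s(a, c) d) :
    d = s(i, b) := by
  induction d using Sym2.ind with
  | _ x y =>
  -- Not crossing `a b` and `b c` forces `x = b`; not crossing `i a` and `c i` forces `y = i`.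
  have key : ∀ x y, s(x, y) ∈ T → sbtw a x c → sbtw c y a → x = b ∧ y = i := by
    intro x y hxy h3 h4
    have hs : IsSide T x y := .inr hxy
    have h5 := hT.not_sides_cross h2 h.left.2.2.1 hs
    have h6 := hT.not_sides_cross h2 h.right.2.2.1 hs
    have h7 := hT.not_sides_cross h2 h.left.2.1 hs.symm
    have h8 := hT.not_sides_cross h2 h.right.2.2.2 hs.symm
    have h9 := h.sbtw_rot
    have h1 := h.left.1
    rw [eq_iff_val, eq_iff_val]
    simp only [sbtw_iff_val] at h1 h3 h4 h5 h6 h7 h8 h9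
    clear h2
    constructor
    · clear h7 h8
      omega
    · clear h5 h6
      omega
  rcases crosses_iff.1 hcr with ⟨h3, h4⟩ | ⟨h3, h4⟩
  · obtain ⟨rfl, rfl⟩ := key x y hd h3 h4
    exact Sym2.eq_swap
  · obtain ⟨rfl, rfl⟩ := key y x (Sym2.eq_swap (a := x) (b := y) ▸ hd) h3 h4
    rfl

omit [NeZero n] h2 in
lemma isSide_flip_iff {x y : ZMod n} : IsSide (flip T i a b c) x y ↔
    s(x, y) = s(a, c) ∨ IsSide T x y ∧ s(x, y) ≠ s(i, b) := by
  unfold IsSide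
  rw [mem_flip]
  have : IsEdge x y → s(x, y) ≠ s(i, b) := fun he => IsEdge.ne_of_isChord he (hT.chord _ h.mem)
  tauto

omit [NeZero n] h2 in
lemma isSide_flip {x y : ZMod n} (hs : IsSide T x y) (hne : s(x, y) ≠ s(i, b)) :
    IsSide (flip T i a b c) x y := (h.isSide_flip_iff hT).2 (.inr ⟨hs, hne⟩)

/-- For maximality, take a chord that crosses nothing in the new set. If it crosses `i b`, it must
avoid the four sides of the quadrilateral, which all survive, and so it is `a c`. Otherwise it
crosses nothing in `T`, hence is in `T`, and it is not `i b`, which crosses `a c`. -/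
lemma isMaximalNoncrossing_flip : IsMaximalNoncrossing (flip T i a b c) where
  chord d hd := by
    rcases mem_flip.1 hd with rfl | ⟨hd, -⟩
    · exact h.isChord h2
    · exact hT.chord d hd
  noncrossing d hd e he hcr := by
    rcases mem_flip.1 hd with rfl | ⟨hd, hd'⟩ <;> rcases mem_flip.1 he with rfl | ⟨he, he'⟩
    · rcases crosses_iff.1 hcr with ⟨h3, -⟩ | ⟨-, h3⟩
      · exact (ne_of_sbtw h3).1 rfl
      · exact (ne_of_sbtw h3).2.1 rfl
    · exact he' (h.eq_of_crosses h2 hT he hcr)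
    · exact hd' (h.eq_of_crosses h2 hT hd hcr.symm)
    · exact hT.noncrossing d hd e he hcr
  maximal d hd hcr := by
    rw [mem_flip]
    by_cases hib : Crosses d s(i, b)
    · left
      induction d using Sym2.ind with
      | _ x y =>
      have hside : ∀ p q, IsSide T p q → s(p, q) ≠ s(i, b) → ∀ x y,
          (∀ e ∈ flip T i a b c, ¬ Crosses s(x, y) e) → ¬ (sbtw p x q ∧ sbtw q y p) := by
        rintro p q (hpq | hpq) hne x y hcr ⟨h3, h4⟩
        · exact not_sbtw_of_isEdge h2 hpq h3 h4
        · exact hcr _ (mem_flip.2 (.inr ⟨hpq, hne⟩)) (Crosses.symm (crosses_iff.2 (.inl ⟨h3, h4⟩)))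
      obtain ⟨n1, n2, n3, n4, n5, n6⟩ := h.ne
      have key : ∀ x y, (∀ e ∈ flip T i a b c, ¬ Crosses s(x, y) e) → sbtw i x b → sbtw b y i →
          x = a ∧ y = c := by
        intro x y hcr h3 h4
        have hcr' : ∀ e ∈ flip T i a b c, ¬ Crosses s(y, x) e := by
          rwa [Sym2.eq_swap]
        have h5 := hside _ _ h.left.2.1 (by simp [n4, n2, n1.symm]) x y hcr
        have h6 := hside _ _ h.left.2.2.1 (by simp [n4, n1.symm]) x y hcr
        have h7 := hside _ _ h.right.2.2.1 (by simp [n6.symm, n2.symm, n3.symm])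
          y x hcr'
        have h8 := hside _ _ h.right.2.2.2 (by simp [n6.symm, n2, n3.symm])
          y x hcr'
        have h9 := h.left.1
        have h1 := h.right.1
        rw [eq_iff_val, eq_iff_val]
        simp only [sbtw_iff_val] at h1 h3 h4 h5 h6 h7 h8 h9
        clear h2
        constructor
        · clear h7 h8
          omega
        · clear h5 h6
          omega
      rcases crosses_iff.1 hib.symm with ⟨h3, h4⟩ | ⟨h3, h4⟩
      · obtain ⟨rfl, rfl⟩ := key x y hcr h3 h4
        rfl
      · obtain ⟨rfl, rfl⟩ := key y x (by rwa [Sym2.eq_swap]) h3 h4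
        exact Sym2.eq_swap
    · right
      refine ⟨hT.maximal d hd fun e he hde => ?_, ?_⟩
      · by_cases hne : e = s(i, b)
        · exact hib (hne ▸ hde)
        · exact hcr e (mem_flip.2 (.inr ⟨he, hne⟩)) hde
      · rintro rfl
        exact hcr _ (mem_flip.2 (.inl rfl)) h.crosses.symm

omit h2 in
/-- The flipped quadrilateral. -/
lemma isQuad_flip : IsQuad (flip T i a b c) a b c i := by
  obtain ⟨n1, n2, n3, n4, n5, n6⟩ := h.ne
  have s1 := h.isSide_flip hT h.left.2.1 (by simp [n4, n2])
  have s2 := h.isSide_flip hT h.left.2.2.1 (by simp [n4, n1.symm])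
  have s3 := h.isSide_flip hT h.right.2.2.1 (by simp [n2.symm, n3.symm])
  have s4 := h.isSide_flip hT h.right.2.2.2 (by simp [n6.symm, n3.symm])
  have hm : s(a, c) ∈ flip T i a b c := mem_flip.2 (.inl rfl)
  exact ⟨⟨h.sbtw_rot.2, s2, s3, (IsSide.symm (.inr hm))⟩, ⟨h.sbtw_rot.1, .inr hm, s4, s1⟩, hm⟩

omit h2 in
-- Makes the situation symmetric: facts about the triangles lost in a flip become facts about those
-- gained.
lemma flip_flip : flip (flip T i a b c) a b c i = T := by
  ext d
  rw [mem_flip, mem_flip, Sym2.eq_swap]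
  have h1 : d = s(a, c) → d ∉ T := fun hd => hd ▸ h.notMem hT
  have h3 : d = s(i, b) → d ∈ T := fun hd => hd ▸ h.mem
  have h4 : d = s(i, b) → d ≠ s(a, c) := fun hd hd' => h1 hd' (h3 hd)
  tauto

lemma isRotation_of_side {x y z : ZMod n} (ht : IsTriangle T x y z) (hs : s(x, y) = s(i, b)) :
    IsRotation x y z i a b ∨ IsRotation x y z i b c := by
  rcases Sym2.eq_iff.1 hs with ⟨rfl, rfl⟩ | ⟨rfl, rfl⟩
  · right
    exact .inl ⟨rfl, rfl, hT.triangle_unique h2 ht h.right⟩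
  · left
    exact .inr (.inr ⟨rfl, rfl, hT.triangle_unique h2 ht h.left.rotate.rotate⟩)

omit [NeZero n] h2 hT h in
lemma _root_.PolygonStar.IsRotation.rotate {x y z i j k : ZMod n}
    (h : IsRotation y z x i j k) : IsRotation x y z i j k := by
  unfold IsRotation at *
  tauto

/-- A triangle is destroyed only if `i b` is one of its sides, and by `triangle_unique` just two
triangles have that side. -/
lemma isTriangle_flip_or {x y z : ZMod n} (ht : IsTriangle T x y z) :
    IsTriangle (flip T i a b c) x y z ∨ IsRotation x y z i a b ∨ IsRotation x y z i b c := by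
  by_cases h3 : s(x, y) = s(i, b)
  · exact .inr (h.isRotation_of_side h2 hT ht h3)
  by_cases h4 : s(y, z) = s(i, b)
  · exact .inr ((h.isRotation_of_side h2 hT ht.rotate h4).imp .rotate .rotate)
  by_cases h5 : s(z, x) = s(i, b)
  · exact .inr ((h.isRotation_of_side h2 hT ht.rotate.rotate h5).imp (fun h => h.rotate.rotate)
      fun h => h.rotate.rotate)
  exact .inl ⟨ht.1, h.isSide_flip hT ht.2.1 h3, h.isSide_flip hT ht.2.2.1 h4,
    h.isSide_flip hT ht.2.2.2 h5⟩

omit h2 in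
lemma not_isSide_flip : ¬ IsSide (flip T i a b c) i b := by
  rw [h.isSide_flip_iff hT]
  obtain ⟨n1, n2, n3, n4, n5, n6⟩ := h.ne
  simp [n1, n3]

omit [NeZero n] h2 hT h in
lemma _root_.PolygonStar.IsTriangle.isSide {x y z p q : ZMod n} (h : IsTriangle T x y z)
    (hp : p ∈ ({x, y, z} : Finset (ZMod n))) (hq : q ∈ ({x, y, z} : Finset (ZMod n)))
    (hpq : p ≠ q) : IsSide T p q := by
  simp only [Finset.mem_insert, Finset.mem_singleton] at hp hq
  obtain ⟨-, h1, h2, h3⟩ := h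
  rcases hp with rfl | rfl | rfl <;> rcases hq with rfl | rfl | rfl <;>
    first
    | exact absurd rfl hpq
    | assumption
    | exact IsSide.symm ‹_›

omit h2 in
lemma not_isTriangle_flip {x y z : ZMod n}
    (hr : IsRotation x y z i a b ∨ IsRotation x y z i b c) :
    ¬ IsTriangle (flip T i a b c) x y z := by
  intro ht
  refine h.not_isSide_flip hT (ht.isSide ?_ ?_ h.ne.2.1) <;>
  · rcases hr with (⟨rfl, rfl, rfl⟩ | ⟨rfl, rfl, rfl⟩ | ⟨rfl, rfl, rfl⟩) |
      (⟨rfl, rfl, rfl⟩ | ⟨rfl, rfl, rfl⟩ | ⟨rfl, rfl, rfl⟩) <;> simp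

omit [NeZero n] h2 hT h in
lemma _root_.PolygonStar.IsRotation.insert_eq {x y z i j k : ZMod n}
    (h : IsRotation x y z i j k) : ({x, y, z} : Finset (ZMod n)) = {i, j, k} := by
  rcases h with ⟨rfl, rfl, rfl⟩ | ⟨rfl, rfl, rfl⟩ | ⟨rfl, rfl, rfl⟩ <;> ext <;> simp <;> tauto

end IsQuad

end Flip

/-! ### Flips preserve triangulations. -/

section FlipTriangulation

open EuclideanGeometry

variable {n : ℕ} [NeZero n] {v : ZMod n → ℂ} {T : Set (Sym2 (ZMod n))} {i a b c : ZMod n}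

/-- The closed plane triangle spanned by three vertices. -/
def hull (v : ZMod n → ℂ) (x y z : ZMod n) : Set ℂ := convexHull ℝ {v x, v y, v z}

/-- The triangle of `T` with the given vertices. -/
def IsTriangle.toTriangle {x y z : ZMod n} (h : IsTriangle T x y z) : Triangle T :=
  ⟨{x, y, z}, x, y, z, rfl, h⟩

omit [NeZero n] in
lemma IsTriangle.hull_toTriangle {x y z : ZMod n} (h : IsTriangle T x y z) :
    h.toTriangle.hull v = hull v x y z := by
  simp [Triangle.hull, hull, IsTriangle.toTriangle, Set.image_insert_eq]

omit [NeZero n] in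
lemma Triangle.exists_eq (t : Triangle T) :
    ∃ x y z, ∃ h : IsTriangle T x y z, t = h.toTriangle := by
  obtain ⟨t, x, y, z, rfl, h⟩ := t
  exact ⟨x, y, z, h, rfl⟩

omit [NeZero n] in
lemma iUnion_hull_eq (v : ZMod n → ℂ) (T : Set (Sym2 (ZMod n))) :
    ⋃ t : Triangle T, t.hull v =
      {p | ∃ x y z, IsTriangle T x y z ∧ p ∈ hull v x y z} := by
  ext p
  rw [Set.mem_iUnion]
  constructor
  · rintro ⟨t, hp⟩
    obtain ⟨x, y, z, ht, rfl⟩ := t.exists_eq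
    exact ⟨x, y, z, ht, by rwa [ht.hull_toTriangle] at hp⟩
  · rintro ⟨x, y, z, ht, hp⟩
    exact ⟨ht.toTriangle, by rwa [ht.hull_toTriangle]⟩

omit [NeZero n] in
lemma IsRotation.hull_eq {x y z i j k : ZMod n} (h : IsRotation x y z i j k) :
    hull v x y z = hull v i j k := by
  have := congrArg (fun s : Finset (ZMod n) => v '' s) h.insert_eq
  simp only [Finset.coe_insert, Finset.coe_singleton, Set.image_insert_eq,
    Set.image_singleton] at this
  rw [hull, hull, this]

lemma IsTriangulation.isMaximalNoncrossing (hT : IsTriangulation v T) :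
    IsMaximalNoncrossing T where
  chord d hd := by
    obtain ⟨a, b, rfl, h1, h2, -⟩ := hT.diagonal d hd
    exact ⟨a, b, rfl, h1, h2⟩
  noncrossing := hT.noncrossing
  maximal := hT.maximal

/-- The angle at `m` of the triangle `x y z`, zero if `m` is not one of its vertices. -/
noncomputable def angleAt (v : ZMod n → ℂ) (m x y z : ZMod n) : ℝ :=
  (if m = x then ∠ (v y) (v x) (v z) else 0) + (if m = y then ∠ (v z) (v y) (v x) else 0) +
    if m = z then ∠ (v x) (v z) (v y) else 0

open Classical in
-- The contribution of one triangle to an `angleSum`: the orientation allows only one ordering of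
-- the two remaining vertices, so nothing is counted twice.
lemma sum_isRotation {x y z : ZMod n} (h : sbtw x y z) (m : ZMod n) :
    (∑ p : ZMod n × ZMod n, if IsRotation m p.1 p.2 x y z then ∠ (v p.1) (v m) (v p.2) else 0) =
      angleAt v m x y z := by
  obtain ⟨h1, h2, h3⟩ := ne_of_sbtw h
  have key : ∀ p : ZMod n × ZMod n,
      (if IsRotation m p.1 p.2 x y z then ∠ (v p.1) (v m) (v p.2) else 0) =
        (if p = (y, z) then if m = x then ∠ (v y) (v x) (v z) else 0 else 0) +
        (if p = (z, x) then if m = y then ∠ (v z) (v y) (v x) else 0 else 0) +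
        (if p = (x, y) then if m = z then ∠ (v x) (v z) (v y) else 0 else 0) := by
    rintro ⟨p, q⟩
    unfold IsRotation
    simp only [Prod.mk.injEq]
    by_cases hx : m = x
    · subst hx
      by_cases hp : p = y ∧ q = z
      · obtain ⟨rfl, rfl⟩ := hp
        simp [h1, h3.symm]
      · simp [h1, h3.symm, hp]
    by_cases hy : m = y
    · subst hy
      by_cases hp : p = z ∧ q = x
      · obtain ⟨rfl, rfl⟩ := hp
        simp [hx, h2]
      · simp [hx, h2, hp]
    by_cases hz : m = z
    · subst hz
      by_cases hp : p = x ∧ q = y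
      · obtain ⟨rfl, rfl⟩ := hp
        simp [hx, hy]
      · simp [hx, hy, hp]
    · simp [hx, hy, hz]
  rw [Finset.sum_congr rfl fun p _ => key p, Finset.sum_add_distrib, Finset.sum_add_distrib]
  simp [angleAt]

open Classical in
/-- The sum of the angles at `m` of the common triangles of `T` and `T'`. -/
noncomputable def commonAngleSum (v : ZMod n → ℂ) (T T' : Set (Sym2 (ZMod n))) (m : ZMod n) : ℝ :=
  ∑ p : ZMod n × ZMod n, if IsTriangle T m p.1 p.2 ∧ IsTriangle T' m p.1 p.2 then
    ∠ (v p.1) (v m) (v p.2) else 0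

open Classical in
lemma commonAngleSum_comm (v : ZMod n → ℂ) (T T' : Set (Sym2 (ZMod n))) (m : ZMod n) :
    commonAngleSum v T T' m = commonAngleSum v T' T m :=
  Finset.sum_congr rfl fun _ _ => if_congr and_comm rfl rfl

namespace IsQuad

variable (h2 : 2 ≤ n) (hT : IsMaximalNoncrossing T) (h : IsQuad T i a b c)
include h2 hT h

open Classical in
lemma angleSum_eq (m : ZMod n) : angleSum v T m =
    commonAngleSum v T (flip T i a b c) m + angleAt v m i a b + angleAt v m i b c := by
  rw [commonAngleSum, ← sum_isRotation h.left.1, ← sum_isRotation h.right.1, ← Finset.sum_add_distrib,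
    ← Finset.sum_add_distrib, angleSum]
  refine Finset.sum_congr rfl fun p _ => ?_
  have h3 := h.not_isTriangle_flip hT (x := m) (y := p.1) (z := p.2)
  have h4 := h.isTriangle_flip_or h2 hT (x := m) (y := p.1) (z := p.2)
  have h5 : IsRotation m p.1 p.2 i a b → IsTriangle T m p.1 p.2 := fun hr => hr.isTriangle h.left
  have h6 : IsRotation m p.1 p.2 i b c → IsTriangle T m p.1 p.2 := fun hr => hr.isTriangle h.right
  have h7 : IsRotation m p.1 p.2 i a b → ¬ IsRotation m p.1 p.2 i b c := by
    intro h8 h9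
    obtain ⟨n1, n2, n3, n4, n5, n6⟩ := h.ne
    have := h8.insert_eq.symm.trans h9.insert_eq
    have : a ∈ ({i, b, c} : Finset (ZMod n)) := this ▸ by simp
    simp [n1.symm, n4, n5] at this
  by_cases hT : IsTriangle T m p.1 p.2
  · by_cases h8 : IsRotation m p.1 p.2 i a b
    · simp [hT, h8, h3 (.inl h8), h7 h8]
    by_cases h9 : IsRotation m p.1 p.2 i b c
    · simp [hT, h8, h9, h3 (.inr h9)]
    · simp [hT, h8, h9, ((h4 hT).resolve_right (by tauto))]
  · have h8 := mt h5 hT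
    have h9 := mt h6 hT
    simp [hT, h8, h9]

/-- The surviving triangles contribute equally before and after, which leaves the angle identities
of `IsFlippable` at the four vertices. -/
lemma angleSum_flip (hg : IsFlippable (v i) (v a) (v b) (v c)) (m : ZMod n) :
    angleSum v (flip T i a b c) m = angleSum v T m := by
  have e1 := h.angleSum_eq h2 hT (v := v) m
  have e2 := (h.isQuad_flip hT).angleSum_eq h2 (h.isMaximalNoncrossing_flip h2 hT) (v := v) m
  rw [h.flip_flip hT, commonAngleSum_comm] at e2
  have key : angleAt v m i a b + angleAt v m i b c = angleAt v m a b c + angleAt v m a c i := by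
    obtain ⟨n1, n2, n3, n4, n5, n6⟩ := h.ne
    unfold angleAt
    by_cases m1 : m = i
    · subst m1
      simp only [n1, n2, n3, if_true, if_false, add_zero, zero_add]
      rw [hg.angle₁]
    by_cases m2 : m = a
    · subst m2
      simp only [n4, n5, n1.symm, if_true, if_false, add_zero, zero_add]
      rw [angle_comm, hg.angle₂, add_comm, angle_comm (v i), angle_comm (v b)]
    by_cases m3 : m = b
    · subst m3
      simp only [n6, n4.symm, n2.symm, if_true, if_false, add_zero, zero_add]
      rw [angle_comm (v c) (v m) (v i), hg.angle₃, angle_comm]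
    by_cases m4 : m = c
    · subst m4
      simp only [n6.symm, n5.symm, n3.symm, if_true, if_false, add_zero, zero_add]
      rw [hg.angle₄, add_comm]
    · simp [m1, m2, m3, m4]
  linarith

end IsQuad

omit [NeZero n] in
lemma hull_subset_iUnion {x y z : ZMod n} (h : IsTriangle T x y z) :
    hull v x y z ⊆ ⋃ t : Triangle T, t.hull v := by
  rw [iUnion_hull_eq]
  exact fun p hp => ⟨x, y, z, h, hp⟩

omit [NeZero n] in
lemma IsFlippable.hull_union' (hg : IsFlippable (v i) (v a) (v b) (v c)) :
    hull v a b c ∪ hull v a c i = hull v i a b ∪ hull v i b c := by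
  rw [IsRotation.hull_eq (x := a) (y := c) (z := i) (i := i) (j := a) (k := c)
    (.inr (.inl ⟨rfl, rfl, rfl⟩)), Set.union_comm, eq_comm]
  exact hg.hull_union

lemma IsQuad.iUnion_hull_subset (h2 : 2 ≤ n) (hT : IsMaximalNoncrossing T)
    (h : IsQuad T i a b c) (hsub : hull v i a b ∪ hull v i b c ⊆ hull v a b c ∪ hull v a c i) :
    ⋃ t : Triangle T, t.hull v ⊆ ⋃ t : Triangle (flip T i a b c), t.hull v := by
  have hq := h.isQuad_flip hT
  rw [iUnion_hull_eq]
  rintro p ⟨x, y, z, ht, hp⟩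
  rcases h.isTriangle_flip_or h2 hT ht with ht' | hr
  · exact hull_subset_iUnion ht' hp
  · have : p ∈ hull v i a b ∪ hull v i b c := by
      rcases hr with hr | hr <;> rw [hr.hull_eq] at hp
      · exact .inl hp
      · exact .inr hp
    rcases hsub this with hp | hp
    · exact hull_subset_iUnion hq.left hp
    · exact hull_subset_iUnion hq.right hp

/-- Flipping a diagonal keeps a triangulation if the geometry allows it. -/
lemma IsTriangulation.flip (h2 : 2 ≤ n) (hT : IsTriangulation v T) (h : IsQuad T i a b c)
    (hg : IsFlippable (v i) (v a) (v b) (v c)) : IsTriangulation v (flip T i a b c) := by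
  have hM := hT.isMaximalNoncrossing
  have hM' := h.isMaximalNoncrossing_flip h2 hM
  have hq := h.isQuad_flip hM
  have hcover : ⋃ t : Triangle (PolygonStar.flip T i a b c), t.hull v = region v := by
    rw [← hT.cover]
    refine (h.iUnion_hull_subset h2 hM hg.hull_union'.ge).antisymm' ?_
    -- The other inclusion is the same lemma for the reverse flip.
    have := hq.iUnion_hull_subset h2 hM' (v := v) (by
      rw [hg.hull_union', IsRotation.hull_eq (x := b) (y := c) (z := i) (i := i) (j := b) (k := c)
        (.inr (.inl ⟨rfl, rfl, rfl⟩)), IsRotation.hull_eq (x := b) (y := i) (z := a) (i := i)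
        (j := a) (k := b) (.inr (.inr ⟨rfl, rfl, rfl⟩)), Set.union_comm])
    rwa [h.flip_flip hM] at this
  refine ⟨fun d hd => ?_, hM'.noncrossing, hM'.maximal, hcover, ?_, fun m => ?_⟩
  · rcases IsQuad.mem_flip.1 hd with rfl | ⟨hd, -⟩
    · obtain ⟨hne, he⟩ := isChord_iff.1 (hM'.chord _ hd)
      refine ⟨a, c, rfl, hne, he, ?_⟩
      -- The new diagonal is a side of a new triangle, and the new triangles cover exactly the
      -- region.
      rw [← hcover]
      refine subset_trans ?_ (hull_subset_iUnion hq.left)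
      exact (convex_convexHull ℝ _).segment_subset (subset_convexHull ℝ _ (by simp))
        (subset_convexHull ℝ _ (by simp))
    · exact hT.diagonal d hd
  · have hdisj : ∀ {x y z x' y' z'}, IsTriangle T x y z → IsTriangle T x' y' z' →
        ({x, y, z} : Finset (ZMod n)) ≠ {x', y', z'} →
        Disjoint (interior (hull v x y z)) (interior (hull v x' y' z')) := by
      intro x y z x' y' z' ht ht' hne
      have := hT.disjoint ht.toTriangle ht'.toTriangle fun he => hne (congrArg Subtype.val he)
      rwa [ht.hull_toTriangle, ht'.hull_toTriangle] at this
    -- One old triangle, with `i` and `b` among its vertices, contains both new ones. A surviving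
    -- triangle differs from it, so it inherits disjointness from both new triangles.
    obtain ⟨x₀, y₀, z₀, ht₀, hi₀, hb₀, hsub₀⟩ : ∃ x y z, IsTriangle T x y z ∧
        i ∈ ({x, y, z} : Finset (ZMod n)) ∧ b ∈ ({x, y, z} : Finset (ZMod n)) ∧
        hull v i a c ∪ hull v a b c ⊆ hull v x y z := by
      rcases hg.hull_subset with hs | hs
      · exact ⟨i, a, b, h.left, by simp, by simp, hs⟩
      · exact ⟨i, b, c, h.right, by simp, by simp, hs⟩
    have hrot : hull v a c i = hull v i a c := IsRotation.hull_eq (.inr (.inl ⟨rfl, rfl, rfl⟩))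
    -- an old triangle and a new one
    have hold : ∀ {x y z x' y' z'}, IsTriangle (PolygonStar.flip T i a b c) x y z →
        IsTriangle T x y z →
        (IsRotation x' y' z' a b c ∨ IsRotation x' y' z' a c i) →
        Disjoint (interior (hull v x y z)) (interior (hull v x' y' z')) := by
      intro x y z x' y' z' ht ht' hr
      refine (hdisj ht' ht₀ ?_).mono_right (interior_mono ?_)
      · intro he
        exact h.not_isSide_flip hM (ht.isSide (he ▸ hi₀) (he ▸ hb₀) h.ne.2.1)
      · refine subset_trans ?_ hsub₀
        rcases hr with hr | hr <;> rw [hr.hull_eq]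
        · exact Set.subset_union_right
        · rw [hrot]
          exact Set.subset_union_left
    have hnew : ∀ {x y z}, IsTriangle (PolygonStar.flip T i a b c) x y z → IsTriangle T x y z ∨
        (IsRotation x y z a b c ∨ IsRotation x y z a c i) := by
      intro x y z ht
      have := hq.isTriangle_flip_or h2 hM' ht
      rwa [h.flip_flip hM] at this
    have hg' : Disjoint (interior (hull v a c i)) (interior (hull v a b c)) := by
      rw [hrot]
      exact hg.disjoint
    intro s t hne
    obtain ⟨x, y, z, hs, rfl⟩ := s.exists_eq
    obtain ⟨x', y', z', ht, rfl⟩ := t.exists_eq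
    rw [hs.hull_toTriangle, ht.hull_toTriangle]
    have hne' : ({x, y, z} : Finset (ZMod n)) ≠ {x', y', z'} := fun he => hne (Subtype.ext he)
    rcases hnew hs with hs' | hs' <;> rcases hnew ht with ht' | ht'
    · exact hdisj hs' ht' hne'
    · exact hold hs hs' ht'
    · exact (hold ht ht' hs').symm
    · rcases hs' with hs' | hs' <;> rcases ht' with ht' | ht'
      · exact absurd (hs'.insert_eq.trans ht'.insert_eq.symm) hne'
      · rw [hs'.hull_eq, ht'.hull_eq]
        exact hg'.symm
      · rw [hs'.hull_eq, ht'.hull_eq]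
        exact hg'
      · exact absurd (hs'.insert_eq.trans ht'.insert_eq.symm) hne'
  · rw [h.angleSum_flip h2 hM hg, hT.angle_sum]

end FlipTriangulation

/-! ### Leaves of the dual graph are ears. -/

section Leaves

variable {n : ℕ} [NeZero n] {T : Set (Sym2 (ZMod n))} {i : ZMod n}

lemma Triangle.card_eq (t : Triangle T) : t.1.card = 3 := by
  obtain ⟨x, y, z, h, rfl⟩ := t.exists_eq
  obtain ⟨h1, h2, h3⟩ := ne_of_sbtw h.1
  exact Finset.card_eq_three.2 ⟨x, y, z, h1, h3.symm, h2, rfl⟩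

omit [NeZero n] in
lemma IsTriangle.toTriangle_rotate {x y z : ZMod n} (h : IsTriangle T x y z) :
    h.rotate.toTriangle = h.toTriangle := by
  refine Subtype.ext ?_
  ext
  simp only [IsTriangle.toTriangle, Finset.mem_insert, Finset.mem_singleton]
  tauto

/-- A leaf has only one side that is a diagonal. -/
lemma IsLeaf.isEdge (h2 : 2 ≤ n) (hT : IsMaximalNoncrossing T) {x y z : ZMod n}
    (h : IsTriangle T x y z) (hl : IsLeaf T h.toTriangle) (hxy : s(x, y) ∈ T) :
    IsEdge y z ∧ IsEdge z x := by
  obtain ⟨u, hu⟩ := Set.ncard_eq_one.1 hl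
  have hxyz : ∀ {x y z : ZMod n} (h : IsTriangle T x y z), s(x, y) ∈ T →
      ∃ w, ∃ h' : IsTriangle T y x w, (dualGraph T).Adj h.toTriangle h'.toTriangle := by
    intro x y z h hxy
    obtain ⟨w, hw⟩ := hT.exists_triangle h2 (Sym2.eq_swap (a := x) (b := y) ▸ hxy)
    refine ⟨w, hw, fun he => ?_, x, y, hxy, by simp [IsTriangle.toTriangle],
      by simp [IsTriangle.toTriangle], by simp [IsTriangle.toTriangle],
      by simp [IsTriangle.toTriangle]⟩
    have he' : ({x, y, z} : Finset (ZMod n)) = {y, x, w} := congrArg Subtype.val he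
    have hz : z ∈ ({y, x, w} : Finset (ZMod n)) := he' ▸ by simp
    have h1 := h.1
    have h3 := hw.1
    simp only [Finset.mem_insert, Finset.mem_singleton, eq_iff_val] at hz
    rw [sbtw_iff_val] at h1 h3
    omega
  have huniq : ∀ w, (dualGraph T).Adj h.toTriangle w → w = u := by
    intro w hw
    have : w ∈ (dualGraph T).neighborSet h.toTriangle := hw
    rwa [hu] at this
  obtain ⟨h1, h3, h4⟩ := ne_of_sbtw h.1
  obtain ⟨w, hw, hadj⟩ := hxyz h hxy
  have hwu := huniq _ hadj
  -- The only neighbour is the triangle across `x y`, which misses `z`. A second diagonal side would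
  -- end at `z` and give a neighbour containing `z`.
  have hcon : ∀ w : Triangle T, (dualGraph T).Adj h.toTriangle w → z ∉ w.1 := by
    intro w' hw' hz
    rw [huniq _ hw', ← hwu] at hz
    refine hadj.ne (Subtype.ext (Finset.eq_of_subset_of_card_le ?_ ?_))
    · intro p hp
      simp only [IsTriangle.toTriangle, Finset.mem_insert, Finset.mem_singleton] at hp hz ⊢
      rcases hp with rfl | rfl | rfl <;> tauto
    · rw [Triangle.card_eq, Triangle.card_eq]
  constructor
  · refine h.2.2.1.resolve_right fun hyz => ?_
    obtain ⟨w', hw', hadj'⟩ := hxyz h.rotate hyz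
    rw [h.toTriangle_rotate] at hadj'
    exact hcon _ hadj' (by simp [IsTriangle.toTriangle])
  · refine h.2.2.2.resolve_right fun hzx => ?_
    obtain ⟨w', hw', hadj'⟩ := hxyz h.rotate.rotate hzx
    rw [h.rotate.toTriangle_rotate, h.toTriangle_rotate] at hadj'
    exact hcon _ hadj' (by simp [IsTriangle.toTriangle])

/-- A leaf associated with `i` is one of the two ears with the diagonal ending at `i`. -/
lemma IsLeaf.eq_ear (h2 : 2 ≤ n) (hT : IsMaximalNoncrossing T) {t : Triangle T}
    (hl : IsLeaf T t) (ha : IsAssociated T i t) :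
    t.1 = {i, i + 1, i + 1 + 1} ∧ s(i, i + 1 + 1) ∈ T ∨
      ∃ m, i = m + 1 + 1 ∧ t.1 = {i, m, m + 1} ∧ s(m, i) ∈ T := by
  obtain ⟨y, z, h, rfl⟩ : ∃ y z, ∃ h : IsTriangle T i y z, t = h.toTriangle := by
    obtain ⟨x, y, z, h, rfl⟩ := t.exists_eq
    have hi := ha.1
    simp only [IsTriangle.toTriangle, Finset.mem_insert, Finset.mem_singleton] at hi
    rcases hi with rfl | rfl | rfl
    · exact ⟨y, z, h, rfl⟩
    · exact ⟨z, x, h.rotate, h.toTriangle_rotate.symm⟩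
    · exact ⟨x, y, h.rotate.rotate, by rw [h.rotate.toTriangle_rotate, h.toTriangle_rotate]⟩
  obtain ⟨-, a, hat, haT⟩ := ha
  have hs := h.1
  have hi1 := val_add_one_cases h2 i
  have hy1 := val_add_one_cases h2 y
  have hz1 := val_add_one_cases h2 z
  have hiv := i.val_lt
  have hyv := y.val_lt
  have hzv := z.val_lt
  simp only [IsTriangle.toTriangle, Finset.mem_insert, Finset.mem_singleton] at hat
  rw [sbtw_iff_val] at hs
  rcases hat with rfl | rfl | rfl
  · exact absurd rfl (isChord_iff.1 (hT.chord _ haT)).1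
  · right
    obtain ⟨h3, h4⟩ := hl.isEdge h2 hT h haT
    have h5 : z = a + 1 := h3.resolve_right fun he => by
      rw [eq_iff_val] at he
      omega
    have h6 : i = z + 1 := h4.resolve_right fun he => by
      rw [eq_iff_val] at he
      omega
    subst h5
    exact ⟨a, h6, rfl, Sym2.eq_swap (a := i) (b := a) ▸ haT⟩
  · left
    have hl' : IsLeaf T h.rotate.rotate.toTriangle := by
      rwa [h.rotate.toTriangle_rotate, h.toTriangle_rotate]
    obtain ⟨h3, h4⟩ := hl'.isEdge h2 hT _ (Sym2.eq_swap (a := i) (b := a) ▸ haT)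
    have h5 : y = i + 1 := h3.resolve_right fun he => by
      rw [eq_iff_val] at he
      omega
    have h6 : a = y + 1 := h4.resolve_right fun he => by
      rw [eq_iff_val] at he
      omega
    subst h5 h6
    exact ⟨rfl, haT⟩

end Leaves

/-! ### Removing the degenerate triangles at a convex vertex. -/

section Main

variable {n : ℕ} [NeZero n] {v : ZMod n → ℂ} {T : Set (Sym2 (ZMod n))} {i : ZMod n}

open EuclideanGeometry

lemma IsTriangulation.angle_le (hT : IsTriangulation v T) {a b : ZMod n}
    (h : IsTriangle T i a b) : ∠ (v a) (v i) (v b) ≤ interiorAngle v i := by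
  classical
  rw [← hT.angle_sum i, angleSum]
  refine le_trans ?_ (Finset.single_le_sum (fun p _ => ?_) (Finset.mem_univ (a, b)))
  · simp [h]
  · split_ifs
    · exact angle_nonneg _ _ _
    · exact le_rfl

/-- With `v i` in the middle, the triangle alone would have angle `π` at `i`, more than the interior
angle. -/
lemma IsTriangulation.sbtw_or_sbtw (hT : IsTriangulation v T) (hv : Function.Injective v)
    (hconvex : interiorAngle v i < Real.pi) {a b : ZMod n} (h : IsTriangle T i a b)
    (hd : IsDegenerate v i a b) : Sbtw ℝ (v i) (v a) (v b) ∨ Sbtw ℝ (v i) (v b) (v a) := by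
  obtain ⟨h1, h2, h3⟩ := ne_of_sbtw h.1
  rcases Collinear.wbtw_or_wbtw_or_wbtw hd with hw | hw | hw
  · exact .inl ⟨hw, hv.ne h1.symm, hv.ne h2⟩
  · exact .inr ⟨hw.symm, hv.ne h3, hv.ne h2.symm⟩
  · have : Sbtw ℝ (v b) (v i) (v a) := ⟨hw, hv.ne h3.symm, hv.ne h1⟩
    have h4 := hT.angle_le h
    rw [this.angle₃₂₁_eq_pi] at h4
    exact absurd h4 hconvex.not_ge

omit [NeZero n] in
lemma IsDegenerate.trans {x y z w : ZMod n} (h : IsDegenerate v x y z) (h' : IsDegenerate v x y w)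
    (hne : v x ≠ v y) : IsDegenerate v x z w := by
  have h1 : v z ∈ affineSpan ℝ {v x, v y} :=
    h.mem_affineSpan_of_mem_of_ne (by simp) (by simp) (by simp) hne
  have h2 : v w ∈ affineSpan ℝ {v x, v y} :=
    h'.mem_affineSpan_of_mem_of_ne (by simp) (by simp) (by simp) hne
  refine (collinear_insert_insert_of_mem_affineSpan_pair h1 h2).subset ?_
  rintro p (rfl | rfl | rfl) <;> simp

omit [NeZero n] in
lemma IsDegenerate.swap {x y z : ZMod n} (h : IsDegenerate v x y z) : IsDegenerate v x z y := by
  unfold IsDegenerate at *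
  rwa [Set.pair_comm]

/-- A degenerate triangle at `i` can be removed by a flip that lowers the degree of `i`. -/
lemma IsTriangulation.exists_isQuad (h2 : 2 ≤ n) (hT : IsTriangulation v T)
    (hv : Function.Injective v)
    (hconvex : interiorAngle v i < Real.pi)
    (hends : ∀ j k, IsTriangle T i j k → j = i + 1 ∨ i = k + 1 → ¬ IsDegenerate v i j k)
    {j k : ZMod n} (h : IsTriangle T i j k) (hd : IsDegenerate v i j k) :
    ∃ a b c, IsQuad T i a b c ∧ (IsDegenerate v i a b ∨ IsDegenerate v i b c) ∧
      IsFlippable (v i) (v a) (v b) (v c) := by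
  have hM := hT.isMaximalNoncrossing
  have hj : ¬ (j = i + 1 ∨ i = k + 1) := fun hjk => hends j k h hjk hd
  push Not at hj
  have h3 := val_add_one_cases h2 i
  have h4 := val_add_one_cases h2 k
  have hs := h.1
  have hiv := i.val_lt
  have hjv := j.val_lt
  have hkv := k.val_lt
  rcases hT.sbtw_or_sbtw hv hconvex h hd with hb | hb
  -- The flip is made across the longest side, `i k`. It is not an edge: `i = k + 1` is excluded by
  -- `hends`, and `k = i + 1` leaves no room for `j` in the cyclic order. The other case is the
  -- mirror image.
  · have hik : s(i, k) ∈ T := by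
      refine h.2.2.2.symm.resolve_left fun he => ?_
      rcases he with he | he
      · rw [he, sbtw_iff_val] at hs
        omega
      · exact hj.2 he
    obtain ⟨c, hc⟩ := hM.exists_triangle h2 hik
    have hq : IsQuad T i j k c := ⟨h, hc, hik⟩
    obtain ⟨n1, n2, n3, n4, n5, n6⟩ := hq.ne
    exact ⟨j, k, c, hq, .inl hd,
      isFlippable_of_sbtw hb (hv.ne n3.symm) (hv.ne n5.symm) (hv.ne n6.symm)⟩
  · have hij : s(i, j) ∈ T := by
      refine h.2.1.resolve_left fun he => ?_
      rcases he with he | he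
      · exact hj.1 he
      · have h5 := val_add_one_cases h2 j
        rw [he, sbtw_iff_val] at hs
        omega
    obtain ⟨c, hc⟩ := hM.exists_triangle h2 (Sym2.eq_swap (a := i) (b := j) ▸ hij)
    have hq : IsQuad T i c j k := ⟨hc.rotate, h, hij⟩
    obtain ⟨n1, n2, n3, n4, n5, n6⟩ := hq.ne
    exact ⟨c, j, k, hq, .inr hd, (isFlippable_of_sbtw hb (hv.ne n1.symm) (hv.ne n5)
      (hv.ne n4)).symm⟩

lemma IsQuad.mem_of_mem_flip {a b c x : ZMod n} (h : IsQuad T i a b c)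
    (hx : s(i, x) ∈ PolygonStar.flip T i a b c) : s(i, x) ∈ T := by
  obtain ⟨n1, n2, n3, n4, n5, n6⟩ := h.ne
  refine (mem_flip.1 hx).elim (fun he => ?_) And.left
  rcases Sym2.eq_iff.1 he with ⟨h1, -⟩ | ⟨h1, -⟩
  · exact absurd h1 n1
  · exact absurd h1 n3

/-- Induction on the degree of `i`. The hypothesis on the end triangles replaces the two ears, since
a flip may destroy an ear but preserves this weaker condition. -/
theorem IsTriangulation.exists_nondegenerate (hT : IsTriangulation v T) (h2 : 2 ≤ n)
    (hv : Function.Injective v) (hconvex : interiorAngle v i < Real.pi) (N : ℕ)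
    (hN : {x | s(i, x) ∈ T}.ncard = N)
    (hends : ∀ j k, IsTriangle T i j k → j = i + 1 ∨ i = k + 1 → ¬ IsDegenerate v i j k) :
    ∃ T' : Set (Sym2 (ZMod n)), IsTriangulation v T' ∧
      (∀ j k : ZMod n, IsTriangle T' i j k → ¬ IsDegenerate v i j k) ∧
      Relation.ReflTransGen (FlipAt v i) T T' := by
  induction N using Nat.strong_induction_on generalizing T with
  | _ N ih =>
  by_cases hex : ∀ j k : ZMod n, IsTriangle T i j k → ¬ IsDegenerate v i j k
  · exact ⟨T, hT, hex, .refl⟩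
  push Not at hex
  obtain ⟨j, k, hjk, hd⟩ := hex
  obtain ⟨a, b, c, hq, hdeg, hg⟩ := hT.exists_isQuad h2 hv hconvex hends hjk hd
  have hM := hT.isMaximalNoncrossing
  have hT' := hT.flip h2 hq hg
  obtain ⟨n1, n2, n3, n4, n5, n6⟩ := hq.ne
  have hlt : {x | s(i, x) ∈ PolygonStar.flip T i a b c}.ncard < N := by
    rw [← hN]
    refine Set.ncard_lt_ncard ⟨fun x hx => hq.mem_of_mem_flip hx, fun hsub => ?_⟩ (Set.toFinite _)
    have hb : s(i, b) ∈ PolygonStar.flip T i a b c := hsub hq.mem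
    exact hq.not_isSide_flip hM (.inr hb)
  suffices hends' : ∀ x y, IsTriangle (PolygonStar.flip T i a b c) i x y →
      x = i + 1 ∨ i = y + 1 → ¬ IsDegenerate v i x y by
    obtain ⟨T', h1, h3, h4⟩ := ih _ hlt hT' rfl hends'
    exact ⟨T', h1, h3, .head ⟨hT, hT', a, b, c, hq.left, hq.right, hdeg, hq.mem, rfl⟩ h4⟩
  intro x y hxy hends' hdeg'
  have hq' := hq.isQuad_flip hM
  have hor := hq'.isTriangle_flip_or h2 (hq.isMaximalNoncrossing_flip h2 hM) hxy
  rw [hq.flip_flip hM] at hor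
  -- The only new triangle at `i` is `i a c`; every other rotation would identify `i` with `a`, `b`
  -- or `c`.
  rcases hor with ht | (⟨e1, e2, e3⟩ | ⟨e1, e2, e3⟩ | ⟨e1, e2, e3⟩) |
    (⟨e1, e2, e3⟩ | ⟨e1, e2, e3⟩ | ⟨e1, e2, e3⟩)
  · exact hends x y ht hends' hdeg'
  · exact n1 e1
  · exact n2 e1
  · exact n3 e1
  · exact n1 e1
  · exact n3 e1
  · subst e2 e3
    -- the new triangle at `i` lies on the line of both old ones if it is degenerate
    have hcol : IsDegenerate v i x b ∧ IsDegenerate v i b y := by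
      rcases hdeg with hdeg | hdeg
      · exact ⟨hdeg, hdeg.trans hdeg' (hv.ne n1)⟩
      · exact ⟨hdeg'.swap.trans hdeg.swap (hv.ne n3), hdeg⟩
    -- The polygon edge of the new triangle at `i` already belonged to the old triangle on that
    -- side.
    rcases hends' with he | he
    · exact hends x b hq.left (.inl he) hcol.1
    · exact hends b y hq.right (.inr he) hcol.2

/-- The diagonal from `i` to `i + 1 + 1` isolates `i + 1`, so the triangle on the edge from `i` to
`i + 1` must be that ear, whose vertices are consecutive. The diagonal from `m` does the same on the
other side. -/
lemma IsTriangulation.not_isDegenerate_of_ears (h2 : 2 ≤ n) (hT : IsTriangulation v T)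
    (hsimp : ∀ i : ZMod n, ¬ Collinear ℝ {v (i - 1), v i, v (i + 1)}) {m : ZMod n}
    (hm : i = m + 1 + 1) (hmi : s(m, i) ∈ T) (hi : s(i, i + 1 + 1) ∈ T) (j k : ZMod n)
    (h : IsTriangle T i j k) (hjk : j = i + 1 ∨ i = k + 1) : ¬ IsDegenerate v i j k := by
  have hM := hT.isMaximalNoncrossing
  intro hd
  have hjv := j.val_lt
  have hkv := k.val_lt
  have hs := h.1
  rcases hjk with rfl | rfl
  · have hcr := hM.not_sides_cross h2 (.inr hi) h.2.2.1
    have hch := (isChord_iff.1 (hM.chord _ hi)).1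
    have h3 := val_add_one_cases h2 i
    have h4 := val_add_one_cases h2 (i + 1)
    have hk : k = i + 1 + 1 := by
      rw [Ne, eq_iff_val] at hch
      rw [eq_iff_val]
      rw [sbtw_iff_val] at hs
      rw [sbtw_iff_val, sbtw_iff_val] at hcr
      omega
    subst hk
    refine hsimp (i + 1) ?_
    rw [add_sub_cancel_right]
    exact hd
  · have hk : k = m + 1 := add_right_cancel hm
    subst hk
    have hcr := hM.not_sides_cross h2 (.inr hmi) h.2.2.1.symm
    have hch := (isChord_iff.1 (hM.chord _ hmi)).1
    have h3 := val_add_one_cases h2 m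
    have h4 := val_add_one_cases h2 (m + 1)
    have hj : j = m := by
      rw [Ne, eq_iff_val] at hch
      rw [eq_iff_val]
      rw [sbtw_iff_val] at hs
      rw [sbtw_iff_val, sbtw_iff_val] at hcr
      omega
    subst hj
    refine hsimp (j + 1) ?_
    rw [add_sub_cancel_right]
    unfold IsDegenerate at hd
    rwa [Set.insert_comm, Set.pair_comm] at hd

end Main

end PolygonStar

theorem mainTheorem6 (n : ℕ) [NeZero n] (v : ZMod n → ℂ)
    (hv : PolygonStar.IsPolygonStar v)
    (hsimp : ∀ i : ZMod n, ¬ Collinear ℝ {v (i - 1), v i, v (i + 1)})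
    (T : Set (Sym2 (ZMod n))) (hT : PolygonStar.IsTriangulation v T)
    (i : ZMod n) (hconvex : PolygonStar.interiorAngle v i < Real.pi)
    (hleaves : ∃ s t : PolygonStar.Triangle T, s ≠ t ∧
      PolygonStar.IsLeaf T s ∧ PolygonStar.IsLeaf T t ∧
      PolygonStar.IsAssociated T i s ∧ PolygonStar.IsAssociated T i t) :
    ∃ T' : Set (Sym2 (ZMod n)), PolygonStar.IsTriangulation v T' ∧
      (∀ j k : ZMod n, PolygonStar.IsTriangle T' i j k → ¬ PolygonStar.IsDegenerate v i j k) ∧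
      Relation.ReflTransGen (PolygonStar.FlipAt v i) T T' := by
  have h2 : 2 ≤ n := le_trans (by norm_num) hv.three_le
  have hM := hT.isMaximalNoncrossing
  refine hT.exists_nondegenerate h2 hv.injective hconvex _ rfl ?_
  obtain ⟨s, t, hst, hs, ht, his, hit⟩ := hleaves
  -- There are only two possible ears with the diagonal ending at `i`, so two different leaves
  -- realise both.
  rcases hs.eq_ear h2 hM his with ⟨hs1, hs2⟩ | ⟨m, hm, hs1, hs2⟩ <;>
    rcases ht.eq_ear h2 hM hit with ⟨ht1, ht2⟩ | ⟨m', hm', ht1, ht2⟩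
  · exact absurd (Subtype.ext (hs1.trans ht1.symm)) hst
  · exact hT.not_isDegenerate_of_ears h2 hsimp hm' ht2 hs2
  · exact hT.not_isDegenerate_of_ears h2 hsimp hm hs2 ht2
  · obtain rfl : m = m' := add_right_cancel (add_right_cancel (hm.symm.trans hm'))
    exact absurd (Subtype.ext (hs1.trans ht1.symm)) hst
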